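/- Fix a positive integer $g$. For $n\ge 1$ let $M_n(\mathbb C)^g$ be the space of $g$-tuples $X=(X_1,\dots,X_g)$ of complex $n\times n$ matrices, and identify $M_1(\mathbb C)^g$ with $\mathbb C^g$. For such tuples put $X\oplus Y=(X_1\oplus Y_1,\dots,X_g\oplus Y_g)$, and let products with a single matrix be taken entrywise. A noncommutative domain is a sequence $\mathcal D=(\mathcal D(n))_{n\ge 1}$ of nonempty, open, connected sets $\mathcal D(n)\subseteq M_n(\mathbb C)^g$ such that $U^*XU\in\mathcal D(n)$ whenever $X\in\mathcal D(n)$ and $U$ is an $n\times n$ unitary matrix, and $X\oplus Y\in\mathcal D(n+m)$ whenever $X\in\mathcal D(n)$, $Y\in\mathcal D(m)$. For $r>0$ let $\mathcal N_r(n)=\{X\in M_n(\mathbb C)^g:\sum_j X_jX_j^*\prec r^2 I_n\}$. The domain $\mathcal D$ is bounded if there is a single $C>0$ with $\mathcal D(n)\subseteq\mathcal N_C(n)$ for all $n$, and it contains an $\varepsilon$-neighborhood of $0$ if there is an $\varepsilon>0$ with $\mathcal N_\varepsilon(n)\subseteq\mathcal D(n)$ for all $n$. A free analytic map $f:\mathcal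 D\to\mathcal D$ is a sequence of holomorphic maps $f[n]:\mathcal D(n)\to\mathcal D(n)$ such that $f[n+m](X\oplus Y)=f[n](X)\oplus f[m](Y)$ for all $X\in\mathcal D(n)$, $Y\in\mathcal D(m)$, and such that $f[n](X)\Gamma=\Gamma f[n](Y)$ whenever $X,Y\in\mathcal D(n)$ and $\Gamma$ is an invertible $n\times n$ matrix with $X\Gamma=\Gamma Y$. A free automorphism of $\mathcal D$ is a free analytic map $f:\mathcal D\to\mathcal D$ all of whose levels $f[n]$ are bijective and whose inverse $(f[n]^{-1})_n$ is again a free analytic map; let $\mathrm{Aut}_{\rm nc}(\mathcal D)$ be the set of free automorphisms of $\mathcal D$. For $h\in\mathrm{Aut}_{\rm nc}(\mathcal D)$ let $\tilde h=h[1]$, which belongs to the group $\mathrm{Aut}(\mathcal D(1))$ (under composition) of biholomorphic maps of $\mathcal D(1)\subseteq\mathbb C^g$ onto itself. Proposition. If $\mathcal D$ is a bounded noncommutative domain containing an $\varepsilon$-neighborhood of $0$ for some $\varepsilon>0$, then $\{\tilde h:h\in\mathrm{Aut}_{\rm nc}(\mathcal D)\}$ is a subgroup of $\mathrm{Aut}(\mathcal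 D(1))$, and it is closed in $\mathrm{Aut}(\mathcal D(1))$ in the topology of compact convergence (uniform convergence on compact subsets of $\mathcal D(1)$). -/

import Mathlib

open Matrix Topology
open scoped ComplexOrder

/- The entrywise sup norm on matrices. All norms on these finite-dimensional spaces are equivalent,
so this choice affects neither holomorphy nor the topologies below. -/
attribute [local instance] Matrix.normedAddCommGroup Matrix.normedSpace

/-! ### Holomorphic maps and automorphism groups -/

section Automorphisms

variable {E F : Type*} [NormedAddCommGroup E] [NormedSpace ℂ E]
  [NormedAddCommGroup F] [NormedSpace ℂ F]

/-- A map `φ : S → F` defined on a subset `S` of a complex normed space is holomorphic (that is,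
complex analytic, when `S` is open in a finite-dimensional space): it is complex
(Fréchet-)differentiable at every point of `S`. As `φ` is only defined on `S`, this is phrased
through an arbitrary extension by values off `S`, which play no role. -/
def IsHolomorphic {S : Set E} (φ : S → F) : Prop :=
  ∃ Φ : E → F, DifferentiableOn ℂ Φ S ∧ ∀ z : S, Φ z = φ z

theorem IsHolomorphic.comp {S T : Set E} {ψ : T → F} {φ : S → T}
    (hψ : IsHolomorphic ψ) (hφ : IsHolomorphic fun z => (φ z : E)) :
    IsHolomorphic fun z => ψ (φ z) := by
  obtain ⟨Ψ, hΨ, hΨψ⟩ := hψ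
  obtain ⟨Φ, hΦ, hΦφ⟩ := hφ
  refine ⟨Ψ ∘ Φ, hΨ.comp hΦ ?_, ?_⟩
  · intro z hz
    have h := hΦφ ⟨z, hz⟩
    simp only at h
    rw [h]
    exact (φ ⟨z, hz⟩).2
  · intro z
    simp only [Function.comp_apply]
    rw [hΦφ z, hΨψ]

theorem isHolomorphic_coe (S : Set E) : IsHolomorphic fun z : S => (z : E) :=
  ⟨id, differentiableOn_id, fun _ => rfl⟩

/-- `Aut(S)`: the group, under composition, of all biholomorphic maps of `S` onto itself. -/
def Aut (S : Set E) : Subgroup (Equiv.Perm S) where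
  carrier := {φ | IsHolomorphic (fun z => (φ z : E)) ∧ IsHolomorphic (fun z => (φ.symm z : E))}
  one_mem' := ⟨isHolomorphic_coe S, isHolomorphic_coe S⟩
  mul_mem' {φ ψ} hφ hψ :=
    ⟨IsHolomorphic.comp (φ := ψ) hφ.1 hψ.1, IsHolomorphic.comp (φ := φ.symm) hψ.2 hφ.2⟩
  inv_mem' {_} hφ := ⟨hφ.2, hφ.1⟩

/-- The topology of compact convergence on `Aut(S)`, i.e. the topology of uniform convergence on
compact subsets of `S`. -/
abbrev compactConvergence (S : Set E) : TopologicalSpace (Aut S) :=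
  TopologicalSpace.induced
    (fun φ => UniformOnFun.ofFun {K : Set S | IsCompact K} fun z => ((φ : Equiv.Perm S) z : E))
    inferInstance

end Automorphisms

/-! ### Noncommutative sets and domains -/

/-- `M_n(ℂ)^g`: the `g`-tuples of complex `n × n` matrices. -/
abbrev MatTuple (g n : ℕ) : Type := Fin g → Matrix (Fin n) (Fin n) ℂ

/-- The direct sum `X ⊕ Y = (X_1 ⊕ Y_1, …, X_g ⊕ Y_g)`, where `X_j ⊕ Y_j` is block diagonal. -/
def directSum {g : ℕ} {n m : ℕ+} (X : MatTuple g n) (Y : MatTuple g m) :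
    MatTuple g (n + m : ℕ+) :=
  fun j => Matrix.reindex finSumFinEquiv finSumFinEquiv (Matrix.fromBlocks (X j) 0 0 (Y j))

/-- A noncommutative set: a sequence of sets `U(n) ⊆ M_n(ℂ)^g`, `n = 1, 2, …`, closed with respect
to simultaneous unitary similarity and with respect to direct sums. -/
structure NCSet (g : ℕ) where
  level : ∀ n : ℕ+, Set (MatTuple g n)
  unitary_mem : ∀ (n : ℕ+) (X : MatTuple g n), X ∈ level n →
    ∀ V ∈ Matrix.unitaryGroup (Fin n) ℂ, (fun j => star V * X j * V) ∈ level n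
  directSum_mem : ∀ (n m : ℕ+) (X : MatTuple g n) (Y : MatTuple g m),
    X ∈ level n → Y ∈ level m → directSum X Y ∈ level (n + m)

instance (g : ℕ) : CoeFun (NCSet g) (fun _ => ∀ n : ℕ+, Set (MatTuple g n)) := ⟨NCSet.level⟩

/-- A noncommutative domain: every level is nonempty, open and connected. -/
def IsNCDomain {g : ℕ} (D : NCSet g) : Prop :=
  ∀ n : ℕ+, IsOpen (D n) ∧ IsConnected (D n)

/-- Level `n` of the noncommutative `r`-neighborhood of `0`:
the tuples `X` with `∑ X_j X_j^* ≺ r²`. -/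
def ncNhd (g : ℕ) (r : ℝ) (n : ℕ) : Set (MatTuple g n) :=
  {X | (((r ^ 2 : ℝ) : ℂ) • (1 : Matrix (Fin n) (Fin n) ℂ) - ∑ j, X j * (X j)ᴴ).PosDef}

/-- A noncommutative set is bounded if there is one `C` with `C² - ∑ X_j X_j^* ≻ 0` for all its
elements `X`, at all levels. -/
def IsNCBounded {g : ℕ} (D : NCSet g) : Prop :=
  ∃ C : ℝ, ∀ n : ℕ+, D n ⊆ ncNhd g C n

/-! ### Free maps and free automorphisms -/

/-- A free map on `U`: a sequence `f[n] : U(n) → M_n(ℂ)^h` that respects direct sums and respects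
similarity. -/
structure IsFreeMap {g h : ℕ} (U : NCSet g) (f : ∀ n : ℕ+, U n → MatTuple h n) : Prop where
  map_directSum : ∀ (n m : ℕ+) (X : U n) (Y : U m),
    f (n + m) ⟨directSum X.1 Y.1, U.directSum_mem n m X.1 Y.1 X.2 Y.2⟩ =
      directSum (f n X) (f m Y)
  map_similarity : ∀ (n : ℕ+) (X Y : U n) (Γ : Matrix (Fin n) (Fin n) ℂ), IsUnit Γ →
    (∀ j, X.1 j * Γ = Γ * Y.1 j) → ∀ j, f n X j * Γ = Γ * f n Y j

/-- A free analytic map: a free map each of whose levels is analytic. -/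
def IsFreeAnalyticMap {g h : ℕ} (U : NCSet g) (f : ∀ n : ℕ+, U n → MatTuple h n) : Prop :=
  IsFreeMap U f ∧ ∀ n : ℕ+, IsHolomorphic (f n)

/-- The free automorphisms of `D`: the free biholomorphisms `h : D → D`, that is, the levelwise
bijective maps such that `h` and its inverse are free analytic maps. (Both are then proper, each
level being a homeomorphism.) -/
structure FreeAut {g : ℕ} (D : NCSet g) where
  toPerm : ∀ n : ℕ+, Equiv.Perm (D n)
  analytic : IsFreeAnalyticMap D fun n X => (toPerm n X : MatTuple g n)
  analytic_symm : IsFreeAnalyticMap D fun n X => ((toPerm n).symm X : MatTuple g n)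

/-- The commutative collapse `h[1]` of a free automorphism `h` of `D`, an automorphism of
`D(1) ⊆ M_1(ℂ)^g = ℂ^g`. -/
def FreeAut.collapse {g : ℕ} {D : NCSet g} (h : FreeAut D) : Aut (D 1) :=
  ⟨h.toPerm 1, h.analytic.2 1, h.analytic_symm.2 1⟩

/-! Take free automorphisms whose collapses converge along an ultrafilter to `φ` in `Aut (D 1)`.
Boundedness and Schwarz-Cauchy estimates make the group act equicontinuously on each level, so the
points of a level whose images converge inside that level form a clopen set
(`IsEquicontinuousAction.exists_tendsto`). That set is nonempty: if `x` moves to `y` at level 1,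
direct sums of copies of `x` move to direct sums of copies of `y`, which stay in `D`
(`exists_tendsto_levelHom`). Connectedness then gives limits everywhere, at all levels, and likewise
for inverses. The limits are mutually inverse free analytic maps (`isFreeAnalyticMap_of_tendsto`),
and level 1 of the limit is `φ`. -/

/-! ### Equicontinuous groups of permutations of a metric space -/

section OrbitDistance

open Filter

variable {S G : Type*} [MetricSpace S] [Group G]

/-- The largest distance between the images of two points under the elements of a group. -/
noncomputable def orbitEDist (ρ : G →* Equiv.Perm S) (x y : S) : ENNReal :=
  ⨆ a : G, edist (ρ a x) (ρ a y)

theorem edist_le_orbitEDist (ρ : G →* Equiv.Perm S) (x y : S) : edist x y ≤ orbitEDist ρ x y := by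
  refine le_trans (le_of_eq ?_) (le_iSup (fun a : G => edist (ρ a x) (ρ a y)) 1)
  simp

theorem orbitEDist_comm (ρ : G →* Equiv.Perm S) (x y : S) :
    orbitEDist ρ x y = orbitEDist ρ y x := by
  simp only [orbitEDist, edist_comm]

theorem orbitEDist_triangle (ρ : G →* Equiv.Perm S) (x y z : S) :
    orbitEDist ρ x z ≤ orbitEDist ρ x y + orbitEDist ρ y z :=
  iSup_le fun a => (edist_triangle _ (ρ a y) _).trans <|
    add_le_add (le_iSup (fun a => edist (ρ a x) (ρ a y)) a)
      (le_iSup (fun a => edist (ρ a y) (ρ a z)) a)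

/-- Right multiplication by `a` permutes the index set of the supremum, so the group acts by
isometries of `orbitEDist`. -/
theorem orbitEDist_map (ρ : G →* Equiv.Perm S) (a : G) (x y : S) :
    orbitEDist ρ (ρ a x) (ρ a y) = orbitEDist ρ x y := by
  unfold orbitEDist
  rw [← (Equiv.mulRight a).iSup_comp (g := fun b => edist (ρ b x) (ρ b y))]
  simp

/-- The group acts equicontinuously. -/
def IsEquicontinuousAction (ρ : G →* Equiv.Perm S) : Prop :=
  ∀ x : S, ∀ ε : ENNReal, 0 < ε → ∀ᶠ y in 𝓝 x, orbitEDist ρ x y ≤ ε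

theorem IsEquicontinuousAction.continuous {ρ : G →* Equiv.Perm S} (h : IsEquicontinuousAction ρ)
    (a : G) : Continuous (ρ a) := by
  refine continuous_iff_continuousAt.2 fun x => EMetric.tendsto_nhds.2 fun ε hε => ?_
  obtain ⟨δ, hδ, hδε⟩ := exists_between hε
  filter_upwards [h x δ hδ] with y hy
  rw [edist_comm]
  exact ((le_iSup (fun a => edist (ρ a x) (ρ a y)) a).trans hy).trans_lt hδε

/-- A pointwise limit of elements of an equicontinuous group takes values in the space everywhere as
soon as it does so at one point. -/
theorem IsEquicontinuousAction.exists_tendsto [LocallyCompactSpace S] [PreconnectedSpace S]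
    {ρ : G →* Equiv.Perm S} (h : IsEquicontinuousAction ρ) (u : Ultrafilter G)
    {x₀ y₀ : S} (h₀ : Tendsto (fun a => ρ a x₀) u (𝓝 y₀)) (x : S) :
    ∃ y, Tendsto (fun a => ρ a x) u (𝓝 y) := by
  set A : Set S := {x | ∃ y, Tendsto (fun a => ρ a x) u (𝓝 y)} with hA
  -- Taking `w = x` makes `A` open; taking `w ∈ A` close to a limit point `x` makes `A` closed.
  have key : ∀ x, ∀ᶠ w in 𝓝 x, w ∈ A → ∀ᶠ y in 𝓝 x, y ∈ A := by
    intro x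
    obtain ⟨K, hK, hKx⟩ := exists_compact_mem_nhds x
    obtain ⟨r, hr, hrK⟩ := EMetric.mem_nhds_iff.1 hKx
    obtain ⟨R, hR, hRr⟩ := exists_between hr
    have hRtop : R ≠ ⊤ := (hRr.trans_le le_top).ne
    -- Five steps of size `s` are used: one from `x` to `w`, two from `ρ a₀ w` through `b` to `ρ a
    -- w`, two from `w` through `x` to `y`.
    obtain ⟨s, hs, hs5⟩ : ∃ s : ENNReal, 0 < s ∧ s + (s + s + (s + s)) ≤ R := by
      refine ⟨R / 5, ENNReal.div_pos hR.ne' (by norm_num), le_of_eq ?_⟩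
      have h5 : R / 5 + (R / 5 + R / 5 + (R / 5 + R / 5)) = 5 * (R / 5) := by ring
      rw [h5, ENNReal.mul_div_cancel (by norm_num) (by norm_num)]
    have hball : ∀ z, orbitEDist ρ x z ≤ R → z ∈ K := fun z hz => hrK <| by
      rw [Metric.mem_eball, edist_comm]
      exact ((edist_le_orbitEDist ρ x z).trans hz).trans_lt hRr
    filter_upwards [h x s hs] with w hw hwA
    obtain ⟨b, hb⟩ := hwA
    filter_upwards [h x s hs] with y hy
    have hev : ∀ᶠ a in (u : Filter G), orbitEDist ρ b (ρ a w) ≤ s := hb.eventually (h b s hs)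
    obtain ⟨a₀, ha₀⟩ := hev.exists
    have hcpt : IsCompact (ρ a₀ '' K) := hK.image (h.continuous a₀)
    -- One fixed `a₀` serves for most `a`: pulled back by `ρ a₀`, the point `ρ a y` stays within `R`
    -- of `x`, so the images remain in a single compact subset of the space.
    have hmem : ∀ᶠ a in (u : Filter G), ρ a y ∈ ρ a₀ '' K := by
      filter_upwards [hev] with a ha
      refine ⟨(ρ a₀).symm (ρ a y), hball _ ?_, by simp⟩
      have e1 : orbitEDist ρ w ((ρ a₀).symm (ρ a y)) = orbitEDist ρ (ρ a₀ w) (ρ a y) := by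
        rw [← orbitEDist_map ρ a₀ w, Equiv.apply_symm_apply]
      have e2 : orbitEDist ρ (ρ a w) (ρ a y) ≤ s + s := by
        rw [orbitEDist_map]
        refine (orbitEDist_triangle ρ w x y).trans (add_le_add ?_ hy)
        rwa [orbitEDist_comm]
      have e3 : orbitEDist ρ (ρ a₀ w) (ρ a w) ≤ s + s := by
        refine (orbitEDist_triangle ρ _ b _).trans (add_le_add ?_ ha)
        rwa [orbitEDist_comm]
      calc orbitEDist ρ x ((ρ a₀).symm (ρ a y))
          ≤ orbitEDist ρ x w + orbitEDist ρ w ((ρ a₀).symm (ρ a y)) := orbitEDist_triangle ρ _ _ _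
        _ ≤ s + (s + s + (s + s)) := by
          rw [e1]
          exact add_le_add hw ((orbitEDist_triangle ρ _ (ρ a w) _).trans (add_le_add e3 e2))
        _ ≤ R := hs5
    obtain ⟨c, -, hc⟩ := hcpt.ultrafilter_le_nhds (u.map fun a => ρ a y) (le_principal_iff.2 hmem)
    exact ⟨c, hc⟩
  have hopen : IsOpen A := isOpen_iff_mem_nhds.2 fun x hx => (key x).self_of_nhds hx
  have hclosed : IsClosed A := by
    refine isClosed_iff_frequently.2 fun x hx => ?_
    obtain ⟨w, hwA, hw⟩ := (hx.and_eventually (key x)).exists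
    exact (hw hwA).self_of_nhds
  have huniv : A = Set.univ := IsClopen.eq_univ ⟨hclosed, hopen⟩ ⟨x₀, y₀, h₀⟩
  exact (huniv ▸ Set.mem_univ x : x ∈ A)

/-- By invariance, `(ρ a).symm y` is as far from `x` as `y` is from `ρ a x`. -/
theorem IsEquicontinuousAction.tendsto_inv {ρ : G →* Equiv.Perm S}
    (h : IsEquicontinuousAction ρ) {l : Filter G} {x y : S}
    (hxy : Tendsto (fun a => ρ a x) l (𝓝 y)) : Tendsto (fun a => (ρ a).symm y) l (𝓝 x) := by
  refine EMetric.tendsto_nhds.2 fun ε hε => ?_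
  obtain ⟨δ, hδ, hδε⟩ := exists_between hε
  filter_upwards [hxy.eventually (h y δ hδ)] with a ha
  have e : orbitEDist ρ ((ρ a).symm y) x = orbitEDist ρ y (ρ a x) := by
    rw [← orbitEDist_map ρ a, Equiv.apply_symm_apply]
  exact ((edist_le_orbitEDist ρ _ _).trans (e.le.trans ha)).trans_lt hδε

end OrbitDistance

/-! ### Bounded families of holomorphic maps -/

section BoundedFamilies

open Filter Metric

variable {E F ι : Type*} [NormedAddCommGroup E] [NormedSpace ℂ E]
  [NormedAddCommGroup F] [NormedSpace ℂ F]

theorem dist_le_of_differentiableOn_of_norm_le {f : E → F} {c z : E} {R M : ℝ}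
    (hf : DifferentiableOn ℂ f (ball c R)) (hM : ∀ w ∈ ball c R, ‖f w‖ ≤ M) (hz : z ∈ ball c R) :
    dist (f z) (f c) ≤ (M + M) / R * dist z c := by
  have hR : 0 < R := nonempty_ball.1 ⟨z, hz⟩
  refine Complex.dist_le_div_mul_dist_of_mapsTo_ball hf (fun w hw => ?_) hz
  rw [mem_closedBall, dist_eq_norm]
  exact (norm_sub_le _ _).trans (add_le_add (hM w hw) (hM c (mem_ball_self hR)))

theorem norm_fderiv_le_of_norm_le {f : E → F} {c : E} {R M : ℝ} (hR : 0 < R)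
    (hf : DifferentiableOn ℂ f (ball c R)) (hM : ∀ w ∈ ball c R, ‖f w‖ ≤ M) :
    ‖fderiv ℂ f c‖ ≤ (M + M) / R := by
  refine Complex.norm_fderiv_le_div_of_mapsTo_ball hf (fun w hw => ?_) hR
  rw [mem_closedBall, dist_eq_norm]
  exact (norm_sub_le _ _).trans (add_le_add (hM w hw) (hM c (mem_ball_self hR)))

/-- Schwarz lemma for a map that agrees with its value at `c` to first order. The constant `4 * M`
is `2 * M` for `f w - f c` plus `2 * M` for `L (w - c)`. -/
theorem norm_taylor_remainder_le {f : E → F} {c z : E} {R M : ℝ}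
    (hf : DifferentiableOn ℂ f (ball c R)) (hM : ∀ w ∈ ball c R, ‖f w‖ ≤ M) (hz : z ∈ ball c R) :
    ‖f z - f c - fderiv ℂ f c (z - c)‖ ≤ 4 * M * (‖z - c‖ / R) ^ 2 := by
  have hR : 0 < R := nonempty_ball.1 ⟨z, hz⟩
  set L := fderiv ℂ f c
  have hL : ‖L‖ ≤ (M + M) / R := norm_fderiv_le_of_norm_le hR hf hM
  have hd : HasFDerivAt f L c := (hf.differentiableAt (ball_mem_nhds c hR)).hasFDerivAt
  have key := Complex.dist_le_mul_div_pow_of_mapsTo_ball_of_isLittleO (n := 1)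
    (f := fun w => f w - L (w - c)) (c := c) (z := z) (R₁ := R) (R₂ := 4 * M)
    (hf.sub (by fun_prop)) ?_ ?_ hz
  · rw [dist_eq_norm, dist_eq_norm] at key
    simpa [sub_right_comm] using key
  · intro w hw
    have h1 := dist_le_of_differentiableOn_of_norm_le hf hM hw
    rw [mem_ball, dist_eq_norm] at hw
    rw [mem_closedBall, dist_eq_norm]
    have h0 : 0 ≤ (M + M) / R := (norm_nonneg L).trans hL
    have h2 : ‖L (w - c)‖ ≤ M + M := by
      refine (L.le_opNorm _).trans ?_
      calc ‖L‖ * ‖w - c‖ ≤ (M + M) / R * R := by gcongr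
        _ = M + M := div_mul_cancel₀ _ hR.ne'
    have h3 : ‖f w - f c‖ ≤ M + M :=
      (norm_sub_le _ _).trans (add_le_add (hM w (by rwa [mem_ball, dist_eq_norm]))
        (hM c (mem_ball_self hR)))
    calc ‖f w - L (w - c) - (f c - L (c - c))‖ = ‖(f w - f c) - L (w - c)‖ := by
          simp [sub_right_comm]
      _ ≤ (M + M) + (M + M) := (norm_sub_le _ _).trans (add_le_add h3 h2)
      _ = 4 * M := by ring
  · have := hd.isLittleO.norm_right
    simpa [sub_right_comm] using this

/-- A pointwise limit of uniformly bounded holomorphic maps is holomorphic. -/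
theorem differentiableOn_of_tendsto_of_norm_le [FiniteDimensional ℂ E] [FiniteDimensional ℂ F]
    {S : Set E} (hS : IsOpen S) (u : Ultrafilter ι) {Φ : ι → E → F} {f : E → F} {M : ℝ}
    (hΦ : ∀ i, DifferentiableOn ℂ (Φ i) S) (hM : ∀ i, ∀ z ∈ S, ‖Φ i z‖ ≤ M)
    (hf : ∀ z ∈ S, Tendsto (fun i => Φ i z) u (𝓝 (f z))) : DifferentiableOn ℂ f S := by
  intro c hc
  obtain ⟨R, hR, hRS⟩ := Metric.isOpen_iff.1 hS c hc
  have : ProperSpace (E →L[ℂ] F) := FiniteDimensional.proper ℂ _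
  -- The derivatives at `c` lie in a compact ball, so they have a limit `L`; the remainder bound is
  -- uniform in `i` and identifies `L` as the derivative of `f`.
  obtain ⟨L, -, hL⟩ := (isCompact_closedBall (0 : E →L[ℂ] F) ((M + M) / R)).ultrafilter_le_nhds
    (u.map fun i => fderiv ℂ (Φ i) c) (by
      simp only [Ultrafilter.coe_map, le_principal_iff, mem_map]
      refine Eventually.of_forall fun i => ?_
      simpa using norm_fderiv_le_of_norm_le hR ((hΦ i).mono hRS) fun w hw => hM i w (hRS hw))
  have hL' : Tendsto (fun i => fderiv ℂ (Φ i) c) u (𝓝 L) := hL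
  have hrem : ∀ z ∈ ball c R, ‖f z - f c - L (z - c)‖ ≤ 4 * M * (‖z - c‖ / R) ^ 2 := by
    intro z hz
    refine le_of_tendsto (((hf z (hRS hz)).sub (hf c hc)).sub (((ContinuousLinearMap.apply ℂ F
      (z - c)).continuous.tendsto L).comp hL')).norm (Eventually.of_forall fun i => ?_)
    exact norm_taylor_remainder_le ((hΦ i).mono hRS) (fun w hw => hM i w (hRS hw)) hz
  refine (HasFDerivAt.differentiableAt (f' := L) ?_).differentiableWithinAt
  refine HasFDerivAt.of_isLittleO ?_
  have hO : (fun z => f z - f c - L (z - c)) =O[𝓝 c] fun z => ‖z - c‖ ^ 2 := by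
    refine Asymptotics.IsBigO.of_bound (4 * M / R ^ 2) ?_
    filter_upwards [ball_mem_nhds c hR] with z hz
    refine (hrem z hz).trans (le_of_eq ?_)
    rw [Real.norm_of_nonneg (by positivity), div_pow]
    ring
  refine hO.trans_isLittleO ?_
  have := (Asymptotics.isLittleO_norm_pow_id (E' := E) one_lt_two).comp_tendsto
    (show Tendsto (fun z => z - c) (𝓝 c) (𝓝 0) by
      exact (continuous_id.sub continuous_const).tendsto' c 0 (sub_self c))
  exact this

end BoundedFamilies
/-! ### Boundedness of the levels -/

/-- Diagonal entries of a positive definite matrix are positive, so every row of `X` has square sum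
below `C ^ 2`. -/
theorem norm_le_of_mem_ncNhd {g n : ℕ} {C : ℝ} {X : MatTuple g n} (hX : X ∈ ncNhd g C n) :
    ‖X‖ ≤ |C| := by
  refine (pi_norm_le_iff_of_nonneg (abs_nonneg C)).2 fun j =>
    (Matrix.norm_le_iff (abs_nonneg C)).2 fun a b => ?_
  have h := (show Matrix.PosDef _ from hX).diag_pos (i := a)
  have hsum : (∑ j, X j * (X j)ᴴ) a a = ((∑ j, ∑ b, ‖X j a b‖ ^ 2 : ℝ) : ℂ) := by
    rw [Matrix.sum_apply]
    push_cast
    refine Finset.sum_congr rfl fun j _ => ?_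
    rw [Matrix.mul_apply]
    refine Finset.sum_congr rfl fun b _ => ?_
    rw [Matrix.conjTranspose_apply, RCLike.star_def, Complex.mul_conj']
  rw [Matrix.sub_apply, hsum, Matrix.smul_apply, Matrix.one_apply_eq, smul_eq_mul, mul_one,
    ← Complex.ofReal_sub, Complex.zero_lt_real, sub_pos] at h
  rw [← abs_of_nonneg (norm_nonneg (X j a b)), ← sq_le_sq]
  calc ‖X j a b‖ ^ 2 ≤ ∑ b, ‖X j a b‖ ^ 2 :=
        Finset.single_le_sum (f := fun b => ‖X j a b‖ ^ 2) (fun _ _ => by positivity)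
          (Finset.mem_univ b)
    _ ≤ ∑ j, ∑ b, ‖X j a b‖ ^ 2 :=
        Finset.single_le_sum (f := fun j => ∑ b, ‖X j a b‖ ^ 2) (fun _ _ => by positivity)
          (Finset.mem_univ j)
    _ ≤ C ^ 2 := h.le

/-! ### Equicontinuity of groups of bounded holomorphic maps -/

section Equicontinuity

open Filter Metric

variable {E G : Type*} [NormedAddCommGroup E] [NormedSpace ℂ E] [Group G]

/-- The Lipschitz constant `(M + M) / R` near `x` does not depend on the group element. -/
theorem isEquicontinuousAction_of_isHolomorphic {S : Set E} (hS : IsOpen S) {M : ℝ}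
    (hM : ∀ z ∈ S, ‖z‖ ≤ M) (ρ : G →* Equiv.Perm S)
    (hρ : ∀ a, IsHolomorphic fun z => (ρ a z : E)) : IsEquicontinuousAction ρ := by
  intro x ε hε
  obtain ⟨R, hR, hRS⟩ := Metric.isOpen_iff.1 hS x x.2
  have hlip : ∀ᶠ y : S in 𝓝 x, orbitEDist ρ x y ≤ ENNReal.ofReal ((M + M) / R * dist y x) := by
    filter_upwards [ball_mem_nhds x hR] with y hy
    refine iSup_le fun a => ?_
    obtain ⟨Φ, hΦ, hΦρ⟩ := hρ a
    rw [edist_comm, Subtype.edist_eq, edist_dist]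
    refine ENNReal.ofReal_le_ofReal ?_
    change dist (ρ a y : E) (ρ a x : E) ≤ _
    rw [← show Φ y = (ρ a y : E) from hΦρ y, ← show Φ x = (ρ a x : E) from hΦρ x]
    refine dist_le_of_differentiableOn_of_norm_le (hΦ.mono hRS) (fun w hw => ?_) hy
    rw [show Φ w = _ from hΦρ ⟨w, hRS hw⟩]
    exact hM _ (ρ a _).2
  have hlim : Tendsto (fun y : S => ENNReal.ofReal ((M + M) / R * dist y x)) (𝓝 x) (𝓝 0) := by
    refine Continuous.tendsto' (ENNReal.continuous_ofReal.comp (by fun_prop)) _ _ ?_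
    simp
  filter_upwards [hlip, hlim.eventually (Iic_mem_nhds hε)] with y h1 h2
  exact h1.trans h2

theorem IsEquicontinuousAction.exists_tendsto_of_isOpen [FiniteDimensional ℂ E] {S : Set E}
    (hS : IsOpen S) (hconn : IsPreconnected S) {ρ : G →* Equiv.Perm S}
    (h : IsEquicontinuousAction ρ) (u : Ultrafilter G) {x₀ y₀ : S}
    (h₀ : Tendsto (fun a => ρ a x₀) u (𝓝 y₀)) (x : S) :
    ∃ y, Tendsto (fun a => ρ a x) u (𝓝 y) := by
  have : ProperSpace E := FiniteDimensional.proper ℂ E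
  have := hS.locallyCompactSpace
  have : PreconnectedSpace S := Subtype.preconnectedSpace hconn
  exact h.exists_tendsto u h₀ x

end Equicontinuity

/-! ### The group of free automorphisms -/

section FreeAutomorphisms

variable {g : ℕ} {D : NCSet g}

theorem IsFreeAnalyticMap.comp {ψ φ : ∀ n : ℕ+, D n → D n}
    (hψ : IsFreeAnalyticMap D fun n X => (ψ n X : MatTuple g n))
    (hφ : IsFreeAnalyticMap D fun n X => (φ n X : MatTuple g n)) :
    IsFreeAnalyticMap D fun n X => (ψ n (φ n X) : MatTuple g n) := by
  refine ⟨⟨fun n m X Y => ?_, fun n X Y Γ hΓ h => ?_⟩, fun n =>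
    IsHolomorphic.comp (ψ := fun X => (ψ n X : MatTuple g n)) (φ := φ n) (hψ.2 n) (hφ.2 n)⟩
  · rw [← hψ.1.map_directSum]
    congr 2
    exact Subtype.ext (hφ.1.map_directSum n m X Y)
  · exact hψ.1.map_similarity n _ _ Γ hΓ (hφ.1.map_similarity n X Y Γ hΓ h)

theorem isFreeAnalyticMap_coe (D : NCSet g) :
    IsFreeAnalyticMap D fun n (X : D n) => (X : MatTuple g n) :=
  ⟨⟨fun _ _ _ _ => rfl, fun _ _ _ _ _ h => h⟩, fun _ => isHolomorphic_coe _⟩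

/-- The group, under levelwise composition, of the free automorphisms of `D`. -/
def freeAutGroup (D : NCSet g) : Subgroup (∀ n : ℕ+, Equiv.Perm (D n)) where
  carrier := {f | IsFreeAnalyticMap D (fun n X => (f n X : MatTuple g n)) ∧
    IsFreeAnalyticMap D (fun n X => ((f n).symm X : MatTuple g n))}
  one_mem' := ⟨isFreeAnalyticMap_coe D, isFreeAnalyticMap_coe D⟩
  mul_mem' {f h} hf hh :=
    ⟨IsFreeAnalyticMap.comp (ψ := fun n => f n) (φ := fun n => h n) hf.1 hh.1,
      IsFreeAnalyticMap.comp (ψ := fun n => (h n).symm) (φ := fun n => (f n).symm) hh.2 hf.2⟩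
  inv_mem' {_} hf := ⟨hf.2, hf.1⟩

/-- The action of the free automorphisms on level `n`. -/
def levelHom (D : NCSet g) (n : ℕ+) : freeAutGroup D →* Equiv.Perm (D n) :=
  (Pi.evalMonoidHom (fun n : ℕ+ => Equiv.Perm (D n)) n).comp (freeAutGroup D).subtype

/-- The commutative collapse as a homomorphism of groups. -/
def collapseHom (D : NCSet g) : freeAutGroup D →* Aut (D 1) where
  toFun f := ⟨levelHom D 1 f, f.2.1.2 1, f.2.2.2 1⟩
  map_one' := rfl
  map_mul' _ _ := rfl

theorem coe_range_collapseHom (D : NCSet g) :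
    ((collapseHom D).range : Set (Aut (D 1))) = Set.range fun h : FreeAut D => h.collapse := by
  ext φ
  constructor
  · rintro ⟨f, rfl⟩
    exact ⟨⟨f.1, f.2.1, f.2.2⟩, rfl⟩
  · rintro ⟨h, rfl⟩
    exact ⟨⟨h.toPerm, h.analytic, h.analytic_symm⟩, rfl⟩

end FreeAutomorphisms

/-! ### Limits of free automorphisms -/

section Limits

open Filter

variable {g : ℕ} {D : NCSet g}

theorem continuous_directSum {n m : ℕ+} :
    Continuous fun p : MatTuple g n × MatTuple g m => directSum p.1 p.2 := by
  unfold directSum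
  fun_prop

/-- Convergence at one point of the first level forces convergence at some point of every level. -/
theorem exists_tendsto_levelHom (u : Ultrafilter (freeAutGroup D)) {x y : D 1}
    (h : Tendsto (fun a => levelHom D 1 a x) u (𝓝 y)) (n : ℕ+) :
    ∃ X Y : D n, Tendsto (fun a => levelHom D n a X) u (𝓝 Y) := by
  induction n using PNat.recOn with
  | one => exact ⟨x, y, h⟩
  | succ n ih =>
    obtain ⟨X, Y, hXY⟩ := ih
    -- The limit of the images of `X ⊕ x` is `Y ⊕ y`, again a point of `D`.
    refine ⟨⟨_, D.directSum_mem n 1 X x X.2 x.2⟩, ⟨_, D.directSum_mem n 1 Y y Y.2 y.2⟩, ?_⟩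
    rw [tendsto_subtype_rng] at hXY h ⊢
    refine ((continuous_directSum.tendsto (Y.1, y.1)).comp (hXY.prodMk_nhds h)).congr fun a => ?_
    exact (a.2.1.1.map_directSum n 1 X x).symm

/-- A pointwise limit of a bounded family of free analytic maps is a free analytic map. -/
theorem isFreeAnalyticMap_of_tendsto {ι : Type*} (u : Ultrafilter ι)
    (hopen : ∀ n, IsOpen (D n)) {M : ℝ} (hM : ∀ n, ∀ X ∈ D n, ‖X‖ ≤ M)
    {f : ι → ∀ n : ℕ+, D n → D n} {F : ∀ n : ℕ+, D n → D n}
    (hf : ∀ i, IsFreeAnalyticMap D fun n X => (f i n X : MatTuple g n))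
    (hF : ∀ n X, Tendsto (fun i => f i n X) u (𝓝 (F n X))) :
    IsFreeAnalyticMap D fun n X => (F n X : MatTuple g n) := by
  have hF' : ∀ (n : ℕ+) (X : D n), Tendsto (fun i => (f i n X : MatTuple g n)) u (𝓝 (F n X)) :=
    fun n X => tendsto_subtype_rng.1 (hF n X)
  refine ⟨⟨fun n m X Y => ?_, fun n X Y Γ hΓ h j => ?_⟩, fun n => ?_⟩
  · refine tendsto_nhds_unique (hF' _ _) ?_
    refine ((continuous_directSum.tendsto ((F n X).1, (F m Y).1)).comp
      ((hF' n X).prodMk_nhds (hF' m Y))).congr fun i => ?_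
    exact ((hf i).1.map_directSum n m X Y).symm
  · have hl : Tendsto (fun i => (f i n X : MatTuple g n) j * Γ) u (𝓝 ((F n X).1 j * Γ)) :=
      ((tendsto_pi_nhds.1 (hF' n X) j).mul_const Γ)
    have hr : Tendsto (fun i => Γ * (f i n Y : MatTuple g n) j) u (𝓝 (Γ * (F n Y).1 j)) :=
      ((tendsto_pi_nhds.1 (hF' n Y) j).const_mul Γ)
    exact tendsto_nhds_unique hl
      (hr.congr fun i => ((hf i).1.map_similarity n X Y Γ hΓ h j).symm)
  · choose Φ hΦ hΦf using fun i => (hf i).2 n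
    classical
    refine ⟨fun z => if hz : z ∈ D n then F n ⟨z, hz⟩ else 0, ?_, fun z => dif_pos z.2⟩
    refine differentiableOn_of_tendsto_of_norm_le (hopen n) u (M := M) hΦ
      (fun i z hz => ?_) fun z hz => ?_
    · rw [show Φ i z = _ from hΦf i ⟨z, hz⟩]
      exact hM n _ (f i n _).2
    · rw [dif_pos hz]
      exact (hF' n ⟨z, hz⟩).congr fun i => (hΦf i ⟨z, hz⟩).symm

theorem exists_freeAut_of_tendsto (hD : IsNCDomain D) (hbdd : IsNCBounded D)
    (u : Ultrafilter (freeAutGroup D)) {x y : D 1}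
    (h : Tendsto (fun a => levelHom D 1 a x) u (𝓝 y)) :
    ∃ F : freeAutGroup D, ∀ n X, Tendsto (fun a => levelHom D n a X) u (𝓝 (levelHom D n F X)) := by
  obtain ⟨C, hC⟩ := hbdd
  have hM : ∀ n, ∀ X ∈ D n, ‖X‖ ≤ |C| := fun n X hX => norm_le_of_mem_ncNhd (hC n hX)
  have hequi : ∀ n, IsEquicontinuousAction (levelHom D n) := fun n =>
    isEquicontinuousAction_of_isHolomorphic (hD n).1 (hM n) _ fun a => a.2.1.2 n
  have hlim : ∀ n X, ∃ Y, Tendsto (fun a => levelHom D n a X) u (𝓝 Y) := by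
    intro n X
    obtain ⟨X₀, Y₀, h₀⟩ := exists_tendsto_levelHom u h n
    exact (hequi n).exists_tendsto_of_isOpen (hD n).1 (hD n).2.isPreconnected u h₀ X
  have hlim_inv : ∀ n X, ∃ Y, Tendsto (fun a => (levelHom D n a).symm X) u (𝓝 Y) := by
    intro n X
    obtain ⟨X₀, Y₀, h₀⟩ := exists_tendsto_levelHom u h n
    have h₁ := (hequi n).tendsto_inv h₀
    -- Inverses converge by the same argument along the inverted ultrafilter, starting from `Y₀ ↦
    -- X₀`.
    obtain ⟨Y, hY⟩ := (hequi n).exists_tendsto_of_isOpen (hD n).1 (hD n).2.isPreconnected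
      (u.map fun a => a⁻¹) (x₀ := Y₀) (y₀ := X₀) (by rw [Ultrafilter.coe_map, tendsto_map'_iff]; exact h₁) X
    rw [Ultrafilter.coe_map, tendsto_map'_iff] at hY
    exact ⟨Y, hY⟩
  choose F hF using hlim
  choose K hK using hlim_inv
  have hKF : ∀ n X, K n (F n X) = X := fun n X =>
    tendsto_nhds_unique (hK n _) ((hequi n).tendsto_inv (hF n X))
  have hFK : ∀ n X, F n (K n X) = X := by
    intro n X
    have := (hequi n).tendsto_inv (l := (u.map fun a => a⁻¹ : Ultrafilter _)) (x := X) (y := K n X)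
      (by rw [Ultrafilter.coe_map, tendsto_map'_iff]; exact hK n X)
    rw [Ultrafilter.coe_map, tendsto_map'_iff] at this
    exact tendsto_nhds_unique (hF n _) this
  refine ⟨⟨fun n => ⟨F n, K n, hKF n, hFK n⟩, ?_, ?_⟩, hF⟩
  · exact isFreeAnalyticMap_of_tendsto u (fun n => (hD n).1) hM (fun a => a.2.1) hF
  · exact isFreeAnalyticMap_of_tendsto u (fun n => (hD n).1) hM (fun a => a.2.2) hK

theorem tendsto_apply_of_tendsto_compactConvergence {ι E : Type*} [NormedAddCommGroup E]
    [NormedSpace ℂ E] {S : Set E} {l : Filter ι} {f : ι → Aut S} {φ : Aut S}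
    (h : Tendsto f l (@nhds _ (compactConvergence S) φ)) (x : S) :
    Tendsto (fun i => (f i : Equiv.Perm S) x) l (𝓝 ((φ : Equiv.Perm S) x)) := by
  rw [nhds_induced, tendsto_comap_iff, UniformOnFun.tendsto_iff_tendstoUniformlyOn] at h
  exact tendsto_subtype_rng.2 ((h {x} isCompact_singleton).tendsto_at rfl)

theorem isClosed_range_collapseHom (hD : IsNCDomain D) (hbdd : IsNCBounded D) :
    IsClosed[compactConvergence (D 1)] ((collapseHom D).range : Set (Aut (D 1))) := by
  let := compactConvergence (D 1)
  refine isClosed_iff_ultrafilter.2 fun φ v hv hmem => ?_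
  -- A choice of lift along the collapse; its arbitrary values off the range do not matter, since
  -- `v` contains the range.
  set s : Aut (D 1) → freeAutGroup D := Function.invFun (collapseHom D)
  have hs : ∀ᶠ ψ in (v : Filter _), collapseHom D (s ψ) = ψ := by
    filter_upwards [hmem] with ψ hψ
    exact Function.invFun_eq hψ
  have hlim : ∀ x : D 1, Tendsto (fun a => levelHom D 1 a x) (v.map s)
      (𝓝 ((φ : Equiv.Perm (D 1)) x)) := by
    intro x
    rw [Ultrafilter.coe_map, tendsto_map'_iff]
    refine (tendsto_apply_of_tendsto_compactConvergence (tendsto_id'.2 hv) x).congr' ?_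
    filter_upwards [hs] with ψ hψ
    exact congrArg (fun χ : Aut (D 1) => (χ : Equiv.Perm (D 1)) x) hψ.symm
  obtain ⟨x, hx⟩ := (hD 1).2.nonempty
  obtain ⟨F, hF⟩ := exists_freeAut_of_tendsto hD hbdd _ (hlim ⟨x, hx⟩)
  refine ⟨F, Subtype.ext (Equiv.ext fun z => ?_)⟩
  exact tendsto_nhds_unique (hF 1 z) (hlim z)

end Limits

theorem mainTheorem7 (g : ℕ) (D : NCSet g) (hD : IsNCDomain D) (hbdd : IsNCBounded D)
    (hnhd : ∃ ε : ℝ, 0 < ε ∧ ∀ n : ℕ+, ncNhd g ε n ⊆ D n) :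
    ∃ G : Subgroup (Aut (D 1)),
      (G : Set (Aut (D 1))) = Set.range (fun h : FreeAut D => h.collapse) ∧
        IsClosed[compactConvergence (D 1)] (G : Set (Aut (D 1))) :=
  ⟨(collapseHom D).range, coe_range_collapseHom D, isClosed_range_collapseHom hD hbdd⟩
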